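/- Let $R$ be an integral domain with quotient field $K$. For a subset $A\subseteq K$ put $(R:A)=\{x\in K: xA\subseteq R\}$; for an ideal $I$ of $R$ write $I^{-1}=(R:I)$, and call $I$ divisorial if $(R:(R:I))=I$. The domain $R$ is an H-domain if each ideal $I$ of $R$ with $I^{-1}=R$ contains a finitely generated ideal $J$ with $J^{-1}=R$. It is a Prüfer domain if each nonzero finitely generated ideal is invertible, and a generalized Dedekind domain if it is a Prüfer domain such that $P\neq P^2$ for each nonzero prime ideal $P$ and each prime ideal is the radical of a finitely generated ideal. An ideal $I$ is locally principal if $IR_M$ is a principal ideal of $R_M$ for each maximal ideal $M$ of $R$, and faithfully flat if it is faithfully flat as an $R$-module. Every generalized Dedekind domain is an H-domain. The domain $D=\mathbb{Z}+X\mathbb{Q}[[X]]$ is a generalized Dedekind domain, and hence an H-domain. Let $I$ be the ideal of $D$ generated by the set $\{\frac1p X : p \text{ a prime number}\}$. Then $I$ is locally principal and faithfully flat, but $I$ is not divisorial and not finitely generated. Consequently, the conjecture of Glaz and Vasconcelos, that every faithfully flat ideal of an H-domain is finitely generated, is false. -/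

import Mathlib

open scoped nonZeroDivisors PowerSeries

namespace FlatIdeals

/-- The inverse `I⁻¹ = (R : I) = {x ∈ K | x I ⊆ R}` of an ideal `I` of a domain `R` with quotient
field `K = Frac R`, as an `R`-submodule of `K`. -/
noncomputable def inv {R : Type*} [CommRing R] [IsDomain R] (I : Ideal R) :
    Submodule R (FractionRing R) :=
  1 / IsLocalization.coeSubmodule (FractionRing R) I

theorem mem_inv {R : Type*} [CommRing R] [IsDomain R] (I : Ideal R) (x : FractionRing R) :
    x ∈ inv I ↔ ∀ a ∈ I, ∃ r : R, algebraMap R (FractionRing R) r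
      = x * algebraMap R (FractionRing R) a := by
  simp [inv, Submodule.mem_div_iff_forall_mul_mem,
    Submodule.mem_one]

/-- `I` is divisorial: `(R : (R : I)) = I`. -/
def IsDivisorial {R : Type*} [CommRing R] [IsDomain R] (I : Ideal R) : Prop :=
  1 / inv I = IsLocalization.coeSubmodule (FractionRing R) I

/-- `I` is locally principal: `I R_M` is a principal ideal of `R_M` for each maximal ideal `M`. -/
def IsLocallyPrincipal {R : Type*} [CommRing R] (I : Ideal R) : Prop :=
  ∀ (M : Ideal R) [M.IsMaximal],
    (I.map (algebraMap R (Localization.AtPrime M))).IsPrincipal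

/-- A domain is an H-domain if each ideal `I` with `I⁻¹ = R` contains a finitely generated
ideal `J` with `J⁻¹ = R`. -/
def IsHDomain (R : Type*) [CommRing R] [IsDomain R] : Prop :=
  ∀ I : Ideal R, inv I = 1 → ∃ J : Ideal R, J.FG ∧ J ≤ I ∧ inv J = 1

/-- A domain is a Prüfer domain if its nonzero finitely generated ideals are invertible. -/
def IsPruferDomain (R : Type*) [CommRing R] [IsDomain R] : Prop :=
  ∀ I : Ideal R, I.FG → I ≠ ⊥ → IsUnit (I : FractionalIdeal R⁰ (FractionRing R))

/-- A generalized Dedekind domain: a Prüfer domain in which no nonzero prime ideal is idempotent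
and each prime ideal is the radical of a finitely generated ideal. -/
structure IsGeneralizedDedekind (R : Type*) [CommRing R] [IsDomain R] : Prop where
  prufer : IsPruferDomain R
  sq_ne : ∀ P : Ideal R, P.IsPrime → P ≠ ⊥ → P ^ 2 ≠ P
  radical_fg : ∀ P : Ideal R, P.IsPrime → ∃ J : Ideal R, J.FG ∧ J.radical = P

/-- The conjecture: in an H-domain, every faithfully flat ideal is finitely generated. -/
def GlazVasconcelosConjecture : Prop :=
  ∀ (R : Type) [CommRing R] [IsDomain R], IsHDomain R →
    ∀ I : Ideal R, Module.FaithfullyFlat R I → I.FG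

/-- The domain `D = ℤ + X ℚ⟦X⟧`: power series over `ℚ` with integral constant coefficient. -/
noncomputable def D : Subring ℚ⟦X⟧ :=
  (Int.castRingHom ℚ).range.comap (PowerSeries.constantCoeff (R := ℚ))

theorem mem_D (f : ℚ⟦X⟧) : f ∈ D ↔ ∃ (n : ℤ) (g : ℚ⟦X⟧), f = (n : ℚ⟦X⟧) + PowerSeries.X * g := by
  constructor
  · rintro ⟨n, hn⟩
    have h : PowerSeries.X ∣ f - (n : ℚ⟦X⟧) := by
      rw [PowerSeries.X_dvd_iff, map_sub, map_intCast, ← hn]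
      simp
    obtain ⟨g, hg⟩ := h
    exact ⟨n, g, by rw [← hg]; ring⟩
  · rintro ⟨n, g, rfl⟩
    exact ⟨n, by simp⟩

/-- The ideal of `D` generated by the elements `X / p`, for `p` a prime number. -/
noncomputable def I : Ideal D :=
  Ideal.span {d : D | ∃ p : ℕ, p.Prime ∧ (d : ℚ⟦X⟧) = PowerSeries.C (1 / (p : ℚ)) * PowerSeries.X}

end FlatIdeals

namespace FlatIdeals

/-! In a generalized Dedekind domain every nonzero maximal ideal is finitely generated
(`fg_of_isMaximal_of_sq_ne`), hence invertible, so its inverse is not `R`. No nonzero proper ideal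
then has inverse `R`, and the H-property follows.

`D` is Bézout: a common power of `X` is split off and the gcd of the leading coefficients is taken.
Every nonzero prime contains `Xℚ⟦X⟧`, so it is `Xℚ⟦X⟧` or is generated by an integer.

The linear coefficients occurring in `I` have denominators not divisible by any `p ^ 2`, yet every
prime occurs as a denominator. A maximal ideal contains at most one prime `p`, and there `X / p`
generates `I` locally. Flatness is torsion-freeness over a Bézout domain, and `M I ≠ I` because one
cannot divide `X / p` by a multiple of `p` inside `I`. The unboundedly many primes make `I` not
finitely generated, and force `xX` to have zero constant coefficient for all `x ∈ I⁻¹`; so `X / 4`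
lies in the divisorial closure but not in `I`. -/

theorem eq_top_of_one_mem_coeSubmodule {R : Type*} [CommRing R] {J : Ideal R}
    (h : (1 : FractionRing R) ∈ IsLocalization.coeSubmodule (FractionRing R) J) :
    J = ⊤ := by
  obtain ⟨y, hy, hy1⟩ := (IsLocalization.mem_coeSubmodule _ _).1 h
  have : y = 1 := IsFractionRing.injective R (FractionRing R) (by rw [hy1, map_one])
  exact (Ideal.eq_top_iff_one J).2 (this ▸ hy)

/-! ### Prüfer domains and the H-property -/

section General

variable {R : Type*} [CommRing R] [IsDomain R]

theorem one_mem_coeSubmodule_mul_inv (hR : IsPruferDomain R) {J : Ideal R} (hJ : J.FG)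
    (h0 : J ≠ ⊥) :
    (1 : FractionRing R) ∈ IsLocalization.coeSubmodule (FractionRing R) J * inv J := by
  obtain ⟨u, hu⟩ := hR J hJ h0
  have h : (J : FractionalIdeal R⁰ (FractionRing R)) * (u⁻¹ : _ˣ) = 1 := by
    rw [← hu, Units.mul_inv]
  have h' := congrArg
    (fun A : FractionalIdeal R⁰ (FractionRing R) => (A : Submodule R (FractionRing R))) h
  simp only [FractionalIdeal.coe_mul, FractionalIdeal.coe_coeIdeal, FractionalIdeal.coe_one] at h'
  have hle : (((u⁻¹ : _ˣ) : FractionalIdeal R⁰ (FractionRing R)) : Submodule R (FractionRing R))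
      ≤ inv J := by
    rw [inv, Submodule.le_div_iff_mul_le, mul_comm, h']
  have hone : (1 : FractionRing R) ∈ (1 : Submodule R (FractionRing R)) := Submodule.one_le.1 le_rfl
  rw [← h'] at hone
  exact mul_le_mul' le_rfl hle hone

theorem eq_top_of_inv_eq_one (hR : IsPruferDomain R) {J : Ideal R} (hJ : J.FG)
    (h0 : J ≠ ⊥) (h : inv J = 1) : J = ⊤ := by
  have h1 := one_mem_coeSubmodule_mul_inv hR hJ h0
  rw [h, mul_one] at h1
  exact eq_top_of_one_mem_coeSubmodule h1

/-- A denominator-free form of "`R_M` is a valuation ring" for `M` maximal. For `b ∈ (a, m)⁻¹` put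
`r = ba`, `t = bm`, so `rm = ta`. If no `s` existed, all such `r` and `t` would lie in `M`, and
invertibility of `(a, m)` would give `1 ∈ M`. -/
theorem exists_notMem_mul_mem_span (hR : IsPruferDomain R) {M : Ideal R} (hM : M ≠ ⊤) {a m : R}
    (ha : a ≠ 0) :
    ∃ s, s ∉ M ∧ (s * m ∈ Ideal.span {a} ∨ s * a ∈ Ideal.span {m}) := by
  by_contra! hcon
  have hspan : Ideal.span {a, m} ≠ ⊥ := fun h =>
    ha (by simpa [h] using Ideal.subset_span (s := {a, m}) (Set.mem_insert a {m}))
  have h1 := one_mem_coeSubmodule_mul_inv hR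
    (Submodule.fg_span (Set.toFinite {a, m})) hspan
  refine hM (eq_top_of_one_mem_coeSubmodule ((show _ ≤ IsLocalization.coeSubmodule _ M from ?_) h1))
  rw [Submodule.mul_le]
  rintro _ hj' b hb
  obtain ⟨j, hj, rfl⟩ := (IsLocalization.mem_coeSubmodule _ _).1 hj'
  obtain ⟨c, d, rfl⟩ := Ideal.mem_span_pair.1 hj
  obtain ⟨r, hr⟩ := (mem_inv _ b).1 hb a (Ideal.subset_span (by simp))
  obtain ⟨t, ht⟩ := (mem_inv _ b).1 hb m (Ideal.subset_span (by simp))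
  have hrt : r * m = t * a := IsFractionRing.injective R (FractionRing R) (by
    rw [map_mul, map_mul, hr, ht]; ring)
  have hrM : r ∈ M := by
    by_contra hrM
    exact (hcon r hrM).1 (Ideal.mem_span_singleton'.2 ⟨t, hrt.symm⟩)
  have htM : t ∈ M := by
    by_contra htM
    exact (hcon t htM).2 (Ideal.mem_span_singleton'.2 ⟨r, hrt⟩)
  refine (IsLocalization.mem_coeSubmodule _ _).2
    ⟨c * r + d * t, M.add_mem (M.mul_mem_left _ hrM) (M.mul_mem_left _ htM), ?_⟩
  simp only [map_add, map_mul, hr, ht]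
  ring

theorem fg_of_isMaximal_of_sq_ne (hR : IsPruferDomain R) {M J : Ideal R} [hM : M.IsMaximal]
    (hsq : M ^ 2 ≠ M) (hJ : J.FG) (hrad : J.radical = M) : M.FG := by
  obtain ⟨a, haM, ha⟩ : ∃ a ∈ M, a ∉ M ^ 2 := by
    by_contra! h
    exact hsq (le_antisymm (Ideal.pow_le_self two_ne_zero) h)
  have ha0 : a ≠ 0 := by rintro rfl; exact ha (zero_mem _)
  have hJM : J ≤ M := hrad ▸ Ideal.le_radical
  -- Equality is checked locally: away from `M` the ideal `J` is already everything, and at `M` any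
  -- `a ∉ M ^ 2` divides every element of `M`.
  suffices h : M = J ⊔ Ideal.span {a} by
    rw [h]
    exact Submodule.FG.sup hJ (Submodule.fg_span_singleton a)
  refine le_antisymm (fun m hm => ?_) (sup_le hJM (by simpa [Ideal.span_le] using haM))
  by_contra hmem
  have htop : (J ⊔ Ideal.span {a}).colon {m} ≠ ⊤ := fun h => hmem (by
    have h1 : (1 : R) ∈ (J ⊔ Ideal.span {a}).colon {m} := h ▸ Submodule.mem_top
    simpa [Submodule.mem_colon_singleton] using h1)
  obtain ⟨N, hN, hle⟩ := Ideal.exists_le_maximal _ htop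
  have hJN : J ≤ N := fun j hj => hle (Submodule.mem_colon_singleton.2
    (Ideal.mul_mem_right _ _ (Ideal.mem_sup_left hj)))
  have hMN : M = N := hM.eq_of_le hN.ne_top (hrad ▸ hN.isPrime.radical_le_iff.2 hJN)
  subst hMN
  obtain ⟨s, hs, h | h⟩ := exists_notMem_mul_mem_span hR hM.ne_top (m := m) ha0
  · exact hs (hle (Submodule.mem_colon_singleton.2 (Ideal.mem_sup_right h)))
  · obtain ⟨r, hr⟩ := Ideal.mem_span_singleton'.1 h
    -- Here `sa = rm` with `s` invertible modulo `M`: if `r ∈ M` then `a ∈ M ^ 2`, and otherwise `r`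
    -- is a multiplier outside `M` carrying `m` into `(a)`.
    by_cases hrM : r ∈ M
    · obtain ⟨t, ht⟩ := hM.exists_inv hs
      obtain ⟨i, hi, hti⟩ := ht
      apply ha
      have : a = t * (r * m) + i * a := by
        rw [hr]; linear_combination -a * hti
      rw [this, pow_two]
      exact add_mem (Ideal.mul_mem_left _ _ (Ideal.mul_mem_mul hrM hm)) (Ideal.mul_mem_mul hi haM)
    · exact hrM (hle (Submodule.mem_colon_singleton.2 (Ideal.mem_sup_right
        (by rw [smul_eq_mul, hr]; exact Ideal.mul_mem_left _ _ (Ideal.mem_span_singleton_self a)))))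

theorem one_le_inv (J : Ideal R) : 1 ≤ inv J := by
  rw [Submodule.one_le, mem_inv]
  exact fun a _ => ⟨a, by rw [one_mul]⟩

theorem inv_anti {J L : Ideal R} (h : J ≤ L) : inv L ≤ inv J := fun x hx =>
  (mem_inv J x).2 fun a ha => (mem_inv L x).1 hx a (h ha)

/-- If `A ≤ M` and `A⁻¹ = R`, then `M⁻¹ = R`, which is impossible for an invertible proper `M`. Only
`A = ⊤` and `A = ⊥` remain, and both are finitely generated. -/
theorem IsGeneralizedDedekind.isHDomain (hR : IsGeneralizedDedekind R) : IsHDomain R := by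
  intro A hA
  by_cases htop : A = ⊤
  · exact ⟨⊤, ⟨{1}, by simp⟩, htop.ge, htop ▸ hA⟩
  by_cases h0 : A = ⊥
  · exact ⟨⊥, Submodule.fg_bot, bot_le, h0 ▸ hA⟩
  obtain ⟨M, hM, hle⟩ := Ideal.exists_le_maximal A htop
  have hM0 : M ≠ ⊥ := fun h => h0 (le_bot_iff.1 (h ▸ hle))
  obtain ⟨J, hJ, hrad⟩ := hR.radical_fg M hM.isPrime
  have hfg := fg_of_isMaximal_of_sq_ne hR.prufer (hR.sq_ne M hM.isPrime hM0) hJ hrad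
  exact (hM.ne_top (eq_top_of_inv_eq_one hR.prufer hfg hM0
    (le_antisymm (hA ▸ inv_anti hle) (one_le_inv M)))).elim

theorem isPruferDomain_of_isBezout [IsBezout R] : IsPruferDomain R := by
  intro J hJ h0
  obtain ⟨x, rfl⟩ := (IsBezout.isPrincipal_of_FG J hJ).principal
  have hx : x ≠ 0 := by rintro rfl; exact h0 (by simp)
  rw [← Ideal.span, FractionalIdeal.coeIdeal_span_singleton]
  have hx' : algebraMap R (FractionRing R) x ≠ 0 := by simpa using hx
  exact IsUnit.of_mul_eq_one (FractionalIdeal.spanSingleton R⁰ (algebraMap R (FractionRing R) x)⁻¹)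
    (by rw [FractionalIdeal.spanSingleton_mul_spanSingleton, mul_inv_cancel₀ hx',
      FractionalIdeal.spanSingleton_one])

end General

/-! ### Divisibility in `D` and the Bézout property -/

theorem mem_D_iff {f : ℚ⟦X⟧} : f ∈ D ↔ ∃ n : ℤ, (n : ℚ) = PowerSeries.constantCoeff f := Iff.rfl

theorem mem_D_of_constantCoeff_eq_zero {f : ℚ⟦X⟧} (hf : PowerSeries.constantCoeff f = 0) :
    f ∈ D := mem_D_iff.2 ⟨0, by simp [hf]⟩

theorem exists_constantCoeff_eq (d : D) :
    ∃ n : ℤ, PowerSeries.constantCoeff (d : ℚ⟦X⟧) = n :=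
  (mem_D_iff.1 d.2).imp fun _ h => h.symm

/-- The quotient `f' / h'` has constant coefficient `k`, so it lies in `D`. The case `k = 0` covers
`f` of order strictly larger than `h`. -/
theorem dvd_of_X_pow_mul {f h : D} {n : ℕ} {f' h' : ℚ⟦X⟧} (hf : (f : ℚ⟦X⟧) = PowerSeries.X ^ n * f')
    (hh : (h : ℚ⟦X⟧) = PowerSeries.X ^ n * h') (h0 : PowerSeries.constantCoeff h' ≠ 0) {k : ℤ}
    (hk : PowerSeries.constantCoeff f' = k * PowerSeries.constantCoeff h') : h ∣ f := by
  refine ⟨⟨f' * h'⁻¹, mem_D_iff.2 ⟨k, ?_⟩⟩, Subtype.ext ?_⟩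
  · rw [map_mul, PowerSeries.constantCoeff_inv, hk, mul_inv_cancel_right₀ h0]
  · rw [MulMemClass.coe_mul, hf, hh]
    linear_combination -PowerSeries.X ^ n * f' * PowerSeries.mul_inv_cancel h' h0

/-- Clearing denominators reduces this to Bézout's identity in `ℤ`; `s` generates `ℤq + ℤr`. -/
theorem exists_int_gcd (q r : ℚ) (h : q ≠ 0 ∨ r ≠ 0) :
    ∃ s : ℚ, s ≠ 0 ∧ (∃ u v : ℤ, s = u * q + v * r) ∧ (∃ k : ℤ, q = k * s) ∧ ∃ l : ℤ, r = l * s := by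
  have hq : (q.den : ℚ) ≠ 0 := by exact_mod_cast q.den_ne_zero
  have hr : (r.den : ℚ) ≠ 0 := by exact_mod_cast r.den_ne_zero
  set a : ℤ := q.num * r.den
  set b : ℤ := r.num * q.den
  have ha : q = a / (q.den * r.den) := by
    simp only [a]; push_cast; rw [mul_div_mul_right _ _ hr, Rat.num_div_den]
  have hb : r = b / (q.den * r.den) := by
    simp only [b]; push_cast; rw [mul_comm (q.den : ℚ), mul_div_mul_right _ _ hq, Rat.num_div_den]
  have hg : ((a.gcd b : ℤ) : ℚ) = a * a.gcdA b + b * a.gcdB b := by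
    exact_mod_cast congrArg (Int.cast : ℤ → ℚ) (Int.gcd_eq_gcd_ab a b)
  obtain ⟨k, hk⟩ := Int.gcd_dvd_left a b
  obtain ⟨l, hl⟩ := Int.gcd_dvd_right a b
  have hk' : (a : ℚ) = (a.gcd b : ℤ) * k := by exact_mod_cast hk
  have hl' : (b : ℚ) = (a.gcd b : ℤ) * l := by exact_mod_cast hl
  have hqk : q = k * (((a.gcd b : ℤ) : ℚ) / (q.den * r.den)) := by
    rw [mul_div_assoc', mul_comm, ← hk', ← ha]
  have hrl : r = l * (((a.gcd b : ℤ) : ℚ) / (q.den * r.den)) := by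
    rw [mul_div_assoc', mul_comm, ← hl', ← hb]
  refine ⟨((a.gcd b : ℤ) : ℚ) / (q.den * r.den), fun h0 => ?_, ⟨a.gcdA b, a.gcdB b, ?_⟩,
    ⟨k, hqk⟩, ⟨l, hrl⟩⟩
  · rw [h0, mul_zero] at hqk hrl
    exact h.elim (· hqk) (· hrl)
  · rw [hg, add_div, mul_comm (a : ℚ), mul_comm (b : ℚ), mul_div_assoc, mul_div_assoc, ← ha, ← hb]

theorem exists_X_pow_mul_pair (f g : ℚ⟦X⟧) (h : f ≠ 0 ∨ g ≠ 0) :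
    ∃ (n : ℕ) (f' g' : ℚ⟦X⟧), f = PowerSeries.X ^ n * f' ∧ g = PowerSeries.X ^ n * g' ∧
      (PowerSeries.constantCoeff f' ≠ 0 ∨ PowerSeries.constantCoeff g' ≠ 0) := by
  classical
  have hex : ∃ n : ℕ, PowerSeries.coeff n f ≠ 0 ∨ PowerSeries.coeff n g ≠ 0 := by
    by_contra! hcon
    exact h.elim (· (PowerSeries.ext fun n => by simpa using (hcon n).1))
      (· (PowerSeries.ext fun n => by simpa using (hcon n).2))
  have hmin : ∀ m < Nat.find hex, PowerSeries.coeff m f = 0 ∧ PowerSeries.coeff m g = 0 :=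
    fun m hm => by simpa [not_or] using Nat.find_min hex hm
  obtain ⟨f', hf⟩ := PowerSeries.X_pow_dvd_iff.2 fun m hm => (hmin m hm).1
  obtain ⟨g', hg⟩ := PowerSeries.X_pow_dvd_iff.2 fun m hm => (hmin m hm).2
  have hspec := Nat.find_spec hex
  refine ⟨_, f', g', hf, hg, ?_⟩
  have key (F F' : ℚ⟦X⟧) (n : ℕ) (hF : F = PowerSeries.X ^ n * F') :
      PowerSeries.coeff n F = PowerSeries.constantCoeff F' := by
    have := PowerSeries.coeff_X_pow_mul F' n 0
    rw [zero_add] at this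
    rw [hF, this, PowerSeries.coeff_zero_eq_constantCoeff_apply]
  rwa [← key f f' _ hf, ← key g g' _ hg]

instance : IsBezout D := by
  rw [IsBezout.iff_span_pair_isPrincipal]
  intro f g
  by_cases h0 : (f : ℚ⟦X⟧) ≠ 0 ∨ (g : ℚ⟦X⟧) ≠ 0
  · obtain ⟨n, f', g', hf, hg, hfg⟩ := exists_X_pow_mul_pair _ _ h0
    obtain ⟨s, hs, ⟨u, v, huv⟩, ⟨k, hk⟩, l, hl⟩ := exists_int_gcd _ _ hfg
    have hcoeff : PowerSeries.constantCoeff ((u : ℚ⟦X⟧) * f' + (v : ℚ⟦X⟧) * g') = s := by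
      simp [huv]
    have hh : (((u : D) * f + (v : D) * g : D) : ℚ⟦X⟧)
        = PowerSeries.X ^ n * ((u : ℚ⟦X⟧) * f' + (v : ℚ⟦X⟧) * g') := by
      push_cast
      rw [hf, hg]; ring
    refine ⟨(u : D) * f + (v : D) * g, le_antisymm ?_ ?_⟩
    · rw [Ideal.span_le, Set.pair_subset_iff]
      refine ⟨Ideal.mem_span_singleton.2 ?_, Ideal.mem_span_singleton.2 ?_⟩
      · exact dvd_of_X_pow_mul hf hh (by rwa [hcoeff]) (by rwa [hcoeff])
      · exact dvd_of_X_pow_mul hg hh (by rwa [hcoeff]) (by rwa [hcoeff])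
    · rw [Submodule.span_singleton_le_iff_mem]
      exact Ideal.mem_span_pair.2 ⟨u, v, rfl⟩
  · push Not at h0
    obtain ⟨hf, hg⟩ := h0
    have hf : f = 0 := Subtype.ext hf
    have hg : g = 0 := Subtype.ext hg
    subst hf hg
    exact ⟨0, by simp⟩

/-! ### Prime ideals of `D` -/

theorem mem_of_isPrime_of_constantCoeff_eq_zero {P : Ideal D} [hP : P.IsPrime] (h0 : P ≠ ⊥)
    {g : D} (hg : PowerSeries.constantCoeff (g : ℚ⟦X⟧) = 0) : g ∈ P := by
  obtain ⟨f, hfP, hf0⟩ := Submodule.exists_mem_ne_zero_of_ne_bot h0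
  have hf0' : (f : ℚ⟦X⟧) ≠ 0 := fun h => hf0 (Subtype.ext h)
  obtain ⟨n, f', hf, hne⟩ : ∃ (n : ℕ) (f' : ℚ⟦X⟧), (f : ℚ⟦X⟧) = PowerSeries.X ^ n * f' ∧
      PowerSeries.constantCoeff f' ≠ 0 := by
    obtain ⟨n, f₁, f₂, h₁, h₂, h | h⟩ := exists_X_pow_mul_pair (f : ℚ⟦X⟧) f (Or.inl hf0')
    exacts [⟨n, f₁, h₁, h⟩, ⟨n, f₂, h₂, h⟩]
  obtain ⟨g', hg'⟩ := PowerSeries.X_dvd_iff.2 hg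
  -- The exponent exceeds the order `n` of `f`, so the quotient has zero constant coefficient and is
  -- in `D`.
  have hdvd : f ∣ g ^ (n + 1) := dvd_of_X_pow_mul (k := 0) (n := n)
    (f' := PowerSeries.X * g' ^ (n + 1)) (by push_cast; rw [hg']; ring) hf hne (by simp)
  exact hP.mem_of_pow_mem _ (P.mem_of_dvd hdvd hfP)

theorem eq_span_intCast_or_constantCoeff_eq_zero {P : Ideal D} [hP : P.IsPrime] (h0 : P ≠ ⊥) :
    (∃ k : ℤ, k ≠ 0 ∧ P = Ideal.span {(k : D)}) ∨
      ∀ d : D, d ∈ P ↔ PowerSeries.constantCoeff (d : ℚ⟦X⟧) = 0 := by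
  -- Since `P` contains `Xℚ⟦X⟧`, it is determined by `P ∩ ℤ = (k)`.
  obtain ⟨k, hk⟩ := (IsPrincipalIdealRing.principal (P.comap (Int.castRingHom D))).principal
  have hmem (n : ℤ) : (n : D) ∈ P ↔ k ∣ n := by
    rw [← Ideal.mem_span_singleton, Ideal.span, ← hk]
    rfl
  have hconst {d : D} {n : ℤ} (hn : PowerSeries.constantCoeff (d : ℚ⟦X⟧) = n) (hd : d ∈ P) :
      k ∣ n := by
    rw [← hmem]
    have : d - (n : D) ∈ P := mem_of_isPrime_of_constantCoeff_eq_zero h0 (by simp [hn])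
    simpa using sub_mem hd this
  by_cases hk0 : k = 0
  · refine Or.inr fun d => ⟨fun hd => ?_, mem_of_isPrime_of_constantCoeff_eq_zero h0⟩
    obtain ⟨n, hn⟩ := exists_constantCoeff_eq d
    have hdvd := hconst hn hd
    rw [hk0, zero_dvd_iff] at hdvd
    rw [hn, hdvd, Int.cast_zero]
  · refine Or.inl ⟨k, hk0, le_antisymm (fun d hd => ?_) ?_⟩
    · obtain ⟨n, hn⟩ := exists_constantCoeff_eq d
      obtain ⟨c, hc⟩ := hconst hn hd
      refine Ideal.mem_span_singleton.2 (dvd_of_X_pow_mul (n := 0) (k := c) (f' := d)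
        (h' := (k : ℚ⟦X⟧)) (by simp) (by simp) (by simpa using hk0) ?_)
      rw [hn, hc]
      simp [mul_comm]
    · rw [Submodule.span_singleton_le_iff_mem]
      exact (hmem k).2 dvd_rfl

/-- The monomial `q X` as an element of `D`. -/
noncomputable def monomial (q : ℚ) : D :=
  ⟨PowerSeries.C q * PowerSeries.X, mem_D_of_constantCoeff_eq_zero (by simp)⟩

@[simp]
theorem coe_monomial (q : ℚ) : (monomial q : ℚ⟦X⟧) = PowerSeries.C q * PowerSeries.X := rfl

theorem intCast_mul_monomial (n : ℤ) (q : ℚ) : (n : D) * monomial q = monomial (n * q) :=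
  Subtype.ext (by simp [mul_assoc])

theorem coeff_one_mul (f g : ℚ⟦X⟧) : PowerSeries.coeff 1 (f * g) =
    PowerSeries.constantCoeff f * PowerSeries.coeff 1 g +
      PowerSeries.coeff 1 f * PowerSeries.constantCoeff g := by
  simp [PowerSeries.coeff_mul, Finset.Nat.antidiagonal_succ]

theorem sq_ne_of_eq_span {R : Type*} [CommRing R] [IsDomain R] {P : Ideal R} [hP : P.IsPrime]
    (h0 : P ≠ ⊥) {x : R} (hx : P = Ideal.span {x}) : P ^ 2 ≠ P := by
  subst hx
  rw [Ideal.span_singleton_pow]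
  intro h
  have hx0 : x ≠ 0 := by rintro rfl; exact h0 (by simp)
  obtain ⟨c, hc⟩ := Ideal.mem_span_singleton.1 (h.ge (Ideal.mem_span_singleton_self x))
  refine hP.ne_top (Ideal.span_singleton_eq_top.2 (IsUnit.of_mul_eq_one c ?_))
  refine mul_left_cancel₀ hx0 ?_
  linear_combination -hc

theorem isGeneralizedDedekind_D : IsGeneralizedDedekind D where
  prufer := isPruferDomain_of_isBezout
  sq_ne P hP h0 := by
    obtain ⟨k, -, hk⟩ | h := eq_span_intCast_or_constantCoeff_eq_zero h0
    · exact sq_ne_of_eq_span h0 hk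
    · intro hsq
      have hle : P ^ 2 ≤ (Ideal.span {PowerSeries.X ^ 2}).comap D.subtype := by
        rw [pow_two, Ideal.mul_le]
        intro a ha b hb
        rw [Ideal.mem_comap, Ideal.mem_span_singleton, pow_two, map_mul]
        exact mul_dvd_mul (PowerSeries.X_dvd_iff.2 ((h a).1 ha))
          (PowerSeries.X_dvd_iff.2 ((h b).1 hb))
      have hX := hle (hsq.ge ((h (monomial 1)).2 (by simp)))
      rw [Ideal.mem_comap, Ideal.mem_span_singleton, PowerSeries.X_pow_dvd_iff] at hX
      simpa using hX 1 one_lt_two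
  radical_fg P hP := by
    by_cases h0 : P = ⊥
    · exact ⟨P, h0 ▸ Submodule.fg_bot, hP.radical⟩
    obtain ⟨k, -, hk⟩ | h := eq_span_intCast_or_constantCoeff_eq_zero h0
    · exact ⟨P, hk ▸ Submodule.fg_span_singleton _, hP.radical⟩
    · refine ⟨Ideal.span {monomial 1}, Submodule.fg_span_singleton _, le_antisymm ?_ ?_⟩
      · rw [hP.radical_le_iff, Ideal.span_le, Set.singleton_subset_iff]
        exact (h _).2 (by simp)
      · intro d hd
        -- The square is needed: `d / X` may have a non-integral constant coefficient, while `d ^ 2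
        -- / X` has constant coefficient `0`.
        refine ⟨2, Ideal.mem_span_singleton.2 ?_⟩
        obtain ⟨g, hg⟩ := PowerSeries.X_dvd_iff.2 ((h d).1 hd)
        exact dvd_of_X_pow_mul (n := 1) (k := 0) (f' := PowerSeries.X * g ^ 2) (h' := 1)
          (by push_cast; rw [hg]; ring) (by simp) (by simp) (by simp)

/-! ### Membership in `I`, local principality and faithful flatness -/

theorem monomial_mem_I {p : ℕ} (hp : p.Prime) : monomial (1 / p) ∈ I :=
  Ideal.subset_span ⟨p, hp, rfl⟩

theorem monomial_one_mem_I : monomial 1 ∈ I := by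
  have := I.mul_mem_left ((2 : ℤ) : D) (monomial_mem_I Nat.prime_two)
  rw [intCast_mul_monomial] at this
  simpa using this

/-- Elements of `I` have zero constant coefficient, and `p ^ 2` does not divide the denominator of
their linear coefficient. -/
theorem exists_coprime_of_mem_I {p : ℕ} (hp : p.Prime) {d : D} (hd : d ∈ I) :
    PowerSeries.constantCoeff (d : ℚ⟦X⟧) = 0 ∧
      ∃ m n : ℤ, ¬ (p : ℤ) ∣ m ∧ m * p * PowerSeries.coeff 1 (d : ℚ⟦X⟧) = n := by
  have hp' : Prime (p : ℤ) := Nat.prime_iff_prime_int.1 hp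
  induction hd using Submodule.span_induction with
  | mem d hd =>
    obtain ⟨q, hq, hd⟩ := hd
    have hq0 : (q : ℚ) ≠ 0 := by exact_mod_cast hq.ne_zero
    refine ⟨by simp [hd], ?_⟩
    by_cases hpq : p = q
    · subst hpq
      exact ⟨1, 1, hp'.not_dvd_one, by simp [hd, hq0]⟩
    · refine ⟨q, p, ?_, by simp [hd]; field_simp⟩
      rwa [Int.natCast_dvd_natCast, Nat.prime_dvd_prime_iff_eq hp hq]
  | zero => exact ⟨by simp, 1, 0, hp'.not_dvd_one, by simp⟩
  | add a b _ _ iha ihb =>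
    obtain ⟨ha, m, n, hm, hmn⟩ := iha
    obtain ⟨hb, m', n', hm', hmn'⟩ := ihb
    refine ⟨by simp [ha, hb], m * m', m' * n + m * n', hp'.not_dvd_mul hm hm', ?_⟩
    push_cast
    rw [map_add]
    linear_combination (m' : ℚ) * hmn + m * hmn'
  | smul c a _ iha =>
    obtain ⟨ha, m, n, hm, hmn⟩ := iha
    obtain ⟨k, hk⟩ := exists_constantCoeff_eq c
    refine ⟨by simp [ha], m, k * n, hm, ?_⟩
    -- As `a` has no constant term, multiplication by `c` only scales its linear coefficient by the
    -- integer `k`.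
    rw [smul_eq_mul, MulMemClass.coe_mul, coeff_one_mul, ha, hk]
    push_cast
    linear_combination (k : ℚ) * hmn

theorem monomial_one_div_mul_notMem_I {p : ℕ} (hp : p.Prime) {k : ℤ} (hk : (p : ℤ) ∣ k)
    (hk0 : k ≠ 0) : monomial (1 / (k * p)) ∉ I := by
  intro h
  obtain ⟨-, m, n, hm, hmn⟩ := exists_coprime_of_mem_I hp h
  have hp0 : (p : ℚ) ≠ 0 := by exact_mod_cast hp.ne_zero
  have hk0' : (k : ℚ) ≠ 0 := by exact_mod_cast hk0
  have : (m : ℚ) = k * n := by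
    rw [← hmn]
    simp
    field_simp
  exact hm (hk.trans ⟨n, by exact_mod_cast this⟩)

theorem isLocallyPrincipal_I : IsLocallyPrincipal I := by
  intro M hM
  obtain ⟨p, hp, hpM⟩ : ∃ p : ℕ, p.Prime ∧ ∀ q : ℕ, q.Prime → q ≠ p → (q : D) ∉ M := by
    by_cases h : ∃ p : ℕ, p.Prime ∧ (p : D) ∈ M
    · obtain ⟨p, hp, hpM⟩ := h
      refine ⟨p, hp, fun q hq hqp hqM => hM.ne_top ((Ideal.eq_top_iff_one M).2 ?_)⟩
      obtain ⟨a, b, hab⟩ := Nat.isCoprime_iff_coprime.2 ((Nat.coprime_primes hq hp).2 hqp)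
      have hab' : (a : D) * q + b * p = 1 := by exact_mod_cast congrArg (Int.cast : ℤ → D) hab
      exact hab' ▸ add_mem (M.mul_mem_left _ hqM) (M.mul_mem_left _ hpM)
    · push Not at h
      -- If `M` contains no prime number, any `p` serves.
      exact ⟨2, Nat.prime_two, fun q hq _ => h q hq⟩
  refine ⟨algebraMap D (Localization.AtPrime M) (monomial (1 / p)), le_antisymm ?_ ?_⟩
  · rw [I, Ideal.map_span, Ideal.span_le]
    rintro _ ⟨d, ⟨q, hq, hd⟩, rfl⟩
    obtain rfl : d = monomial (1 / q) := Subtype.ext hd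
    by_cases hqp : q = p
    · exact hqp ▸ Submodule.mem_span_singleton_self _
    have hp0 : (p : ℚ) ≠ 0 := by exact_mod_cast hp.ne_zero
    have hq0 : (q : ℚ) ≠ 0 := by exact_mod_cast hq.ne_zero
    have hunit : IsUnit (algebraMap D (Localization.AtPrime M) q) :=
      IsLocalization.map_units _ (⟨q, hpM q hq hqp⟩ : M.primeCompl)
    have heq : (q : D) * monomial (1 / q) = p * monomial (1 / p) := by
      have h1 := intCast_mul_monomial q (1 / q)
      have h2 := intCast_mul_monomial p (1 / p)
      push_cast at h1 h2
      rw [h1, h2, mul_one_div_cancel hp0, mul_one_div_cancel hq0]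
    refine (Ideal.unit_mul_mem_iff_mem _ hunit).1 ?_
    rw [← map_mul, heq, map_mul]
    exact Ideal.mul_mem_left _ _ (Submodule.mem_span_singleton_self _)
  · rw [Submodule.span_singleton_le_iff_mem]
    exact Ideal.mem_map_of_mem _ (monomial_mem_I hp)

/-- By the classification of primes it suffices to exclude ideals of series without constant term:
these lie in the proper ideal `(2)`, so a maximal one would equal `(2)`, which contains `2`. -/
theorem exists_eq_span_of_isMaximal {M : Ideal D} [hM : M.IsMaximal] :
    ∃ (k : ℤ) (p : ℕ), k ≠ 0 ∧ p.Prime ∧ (p : ℤ) ∣ k ∧ M = Ideal.span {(k : D)} := by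
  have h2 : Ideal.span {((2 : ℤ) : D)} ≠ ⊤ := fun h => by
    obtain ⟨c, hc⟩ := Ideal.mem_span_singleton.1 ((Ideal.eq_top_iff_one _).1 h)
    obtain ⟨n, hn⟩ := exists_constantCoeff_eq c
    have h1 := congrArg (fun d : D => PowerSeries.constantCoeff (d : ℚ⟦X⟧)) hc
    have h2 : (1 : ℚ) = ((2 : ℤ) : ℚ) * n := by
      rw [← hn]
      simpa only [OneMemClass.coe_one, map_one, MulMemClass.coe_mul, map_mul,
        SubringClass.coe_intCast, map_intCast] using h1
    have : (1 : ℤ) = 2 * n := by exact_mod_cast h2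
    omega
  have hle {N : Ideal D} (h : ∀ d ∈ N, PowerSeries.constantCoeff (d : ℚ⟦X⟧) = 0) :
      N ≤ Ideal.span {((2 : ℤ) : D)} := fun d hd => Ideal.mem_span_singleton.2
    (dvd_of_X_pow_mul (n := 0) (k := 0) (f' := d) (h' := ((2 : ℤ) : ℚ⟦X⟧)) (by simp)
      (by rw [pow_zero, one_mul, SubringClass.coe_intCast]) (by rw [map_intCast]; norm_num)
      (by simp [h d hd]))
  have hex (h : ∀ d ∈ M, PowerSeries.constantCoeff (d : ℚ⟦X⟧) = 0) : False := by
    have h2M : ((2 : ℤ) : D) ∈ M := (hM.eq_of_le h2 (hle h)).ge (Ideal.mem_span_singleton_self _)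
    have := h _ h2M
    rw [SubringClass.coe_intCast, map_intCast] at this
    norm_num at this
  have h0 : M ≠ ⊥ := by
    rintro rfl
    exact hex (by rintro d hd; rw [Ideal.mem_bot] at hd; simp [hd])
  obtain ⟨k, hk0, hk⟩ | h := eq_span_intCast_or_constantCoeff_eq_zero h0
  · have hk1 : k.natAbs ≠ 1 := fun h1 => hM.ne_top (by
      rw [hk, Ideal.span_singleton_eq_top]
      exact (Int.isUnit_iff_natAbs_eq.2 h1).map (Int.castRingHom D))
    obtain ⟨p, hp, hpk⟩ := Nat.exists_prime_and_dvd hk1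
    exact ⟨k, p, hk0, hp, Int.natCast_dvd.2 hpk, hk⟩
  · exact (hex fun d hd => (h d).1 hd).elim

/-- With `M = (k)` and `p ∣ k`, the equality `M I = I` would give `X / p = kx` with `x ∈ I`, that is
`x = X / (kp)`, whose denominator is divisible by `p ^ 2`. -/
theorem faithfullyFlat_I : Module.FaithfullyFlat D I where
  toFlat := by
    rw [Module.Flat.flat_iff_torsion_eq_bot_of_isBezout,
      ← Submodule.isTorsionFree_iff_torsion_eq_bot]
    infer_instance
  submodule_ne_top := by
    intro M hM htop
    obtain ⟨k, p, hk0, hp, hpk, rfl⟩ := exists_eq_span_of_isMaximal (M := M)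
    have hmem : (⟨monomial (1 / p), monomial_mem_I hp⟩ : I) ∈
        Ideal.span {(k : D)} • (⊤ : Submodule D I) := by
      rw [htop]; exact Submodule.mem_top
    rw [Submodule.ideal_span_singleton_smul] at hmem
    obtain ⟨x, -, hx⟩ := (Submodule.mem_smul_pointwise_iff_exists _ _ _).1 hmem
    have hk0' : (k : ℚ) ≠ 0 := by exact_mod_cast hk0
    have hx' : (k : D) * x = (k : D) * monomial (1 / (k * p)) := by
      rw [intCast_mul_monomial, ← div_div, mul_div_assoc', mul_one_div_cancel hk0']
      exact congrArg Subtype.val hx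
    have hkD : (k : D) ≠ 0 := by
      intro h
      simpa [hk0] using congrArg (fun d : D => PowerSeries.constantCoeff (d : ℚ⟦X⟧)) h
    exact monomial_one_div_mul_notMem_I hp hpk hk0 (mul_left_cancel₀ hkD hx' ▸ x.2)

/-! ### Failure of divisoriality and of finite generation -/

theorem eq_zero_of_forall_prime_dvd {n : ℤ} (h : ∀ p : ℕ, p.Prime → (p : ℤ) ∣ n) : n = 0 := by
  by_contra hn
  obtain ⟨p, hle, hp⟩ := Nat.exists_infinite_primes (n.natAbs + 1)
  have := Nat.le_of_dvd (Int.natAbs_pos.2 hn) (Int.natCast_dvd.1 (h p hp))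
  omega

theorem not_isDivisorial_I : ¬ IsDivisorial I := by
  intro hdiv
  have hinj := IsFractionRing.injective D (FractionRing D)
  have hmem : algebraMap D (FractionRing D) (monomial (1 / (2 * 2))) ∈ 1 / inv I := by
    rw [Submodule.mem_div_iff_forall_mul_mem]
    intro x hx
    rw [mem_inv] at hx
    obtain ⟨d, hd⟩ := hx _ monomial_one_mem_I
    obtain ⟨n, hn⟩ := exists_constantCoeff_eq d
    -- For every prime `p`, `d = xX = p · (x · X / p)` with the second factor in `D`, so `p ∣ n`.
    -- Without a constant term, `d` is divisible by `4` in `D`.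
    have hn0 : n = 0 := eq_zero_of_forall_prime_dvd fun p hp => by
      obtain ⟨e, he⟩ := hx _ (monomial_mem_I hp)
      obtain ⟨l, hl⟩ := exists_constantCoeff_eq e
      have hp0 : (p : ℚ) ≠ 0 := by exact_mod_cast hp.ne_zero
      have hmon := intCast_mul_monomial p (1 / p)
      rw [Int.cast_natCast, Int.cast_natCast, mul_one_div_cancel hp0] at hmon
      have hde : d = p * e := hinj (by
        rw [hd, ← hmon, map_mul, map_mul, he]; ring)
      refine ⟨l, ?_⟩
      have : (n : ℚ) = p * l := by rw [← hn, ← hl, hde]; simp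
      exact_mod_cast this
    rw [hn0, Int.cast_zero] at hn
    have h4 : ((4 : ℤ) : D) ∣ d := dvd_of_X_pow_mul (n := 0) (k := 0) (f' := d) (h' := ((4 : ℤ) : ℚ⟦X⟧))
      (by simp) (by rw [pow_zero, one_mul, SubringClass.coe_intCast])
      (by rw [map_intCast]; norm_num) (by simp [hn])
    obtain ⟨e, he⟩ := h4
    have h4 : ((4 : ℤ) : D) ≠ 0 := fun h => by
      have := congrArg (fun d : D => PowerSeries.constantCoeff (d : ℚ⟦X⟧)) h
      simp only [SubringClass.coe_intCast, map_intCast, ZeroMemClass.coe_zero, map_zero] at this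
      norm_num at this
    refine Submodule.mem_one.2 ⟨e, ?_⟩
    have h4' : algebraMap D (FractionRing D) ((4 : ℤ) : D) ≠ 0 := by
      rwa [Ne, map_eq_zero_iff _ hinj]
    refine mul_left_cancel₀ h4' ?_
    rw [← map_mul, ← he, hd, ← mul_assoc, ← map_mul, intCast_mul_monomial, mul_comm]
    norm_num
  rw [hdiv, IsLocalization.mem_coeSubmodule] at hmem
  obtain ⟨y, hy, hxy⟩ := hmem
  refine monomial_one_div_mul_notMem_I Nat.prime_two (k := 2) (by norm_num) two_ne_zero ?_
  have := hinj hxy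
  subst this
  simpa using hy

theorem not_fg_I : ¬ I.FG := by
  intro hfg
  obtain ⟨h, hh⟩ := (IsBezout.isPrincipal_of_FG I hfg).principal
  have hhI : h ∈ I := hh ▸ Submodule.mem_span_singleton_self h
  have h0 := (exists_coprime_of_mem_I Nat.prime_two hhI).1
  -- Comparing linear coefficients in `X / p = ch` gives `1 / p = nr`, where `r` is the linear
  -- coefficient of the generator; hence every prime divides the denominator of `r`.
  have hden : ((PowerSeries.coeff 1 (h : ℚ⟦X⟧)).den : ℤ) = 0 :=
    eq_zero_of_forall_prime_dvd fun p hp => by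
      have hp0 : (p : ℚ) ≠ 0 := by exact_mod_cast hp.ne_zero
      have hmem := monomial_mem_I hp
      rw [hh] at hmem
      obtain ⟨c, hc⟩ := Submodule.mem_span_singleton.1 hmem
      obtain ⟨n, hn⟩ := exists_constantCoeff_eq c
      have h1 := congrArg (fun d : D => PowerSeries.coeff 1 (d : ℚ⟦X⟧)) hc
      simp only [smul_eq_mul, MulMemClass.coe_mul, coeff_one_mul, h0, hn] at h1
      set r := PowerSeries.coeff 1 (h : ℚ⟦X⟧)
      have hr : (r.den : ℚ) ≠ 0 := by exact_mod_cast r.den_ne_zero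
      have h2 : (n : ℚ) * r = 1 / p := by simpa using h1
      refine ⟨n * r.num, ?_⟩
      rw [← Rat.num_div_den r] at h2
      field_simp at h2
      have h3 : (r.den : ℚ) = p * (n * r.num) := by linear_combination -h2
      exact_mod_cast h3
  exact Rat.den_ne_zero _ (by exact_mod_cast hden)

end FlatIdeals

theorem mainTheorem5 :
    (∀ (R : Type*) [CommRing R] [IsDomain R],
      FlatIdeals.IsGeneralizedDedekind R → FlatIdeals.IsHDomain R) ∧
    FlatIdeals.IsGeneralizedDedekind FlatIdeals.D ∧
    FlatIdeals.IsHDomain FlatIdeals.D ∧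
    FlatIdeals.IsLocallyPrincipal FlatIdeals.I ∧
    Module.FaithfullyFlat FlatIdeals.D FlatIdeals.I ∧
    ¬ FlatIdeals.IsDivisorial FlatIdeals.I ∧
    ¬ FlatIdeals.I.FG ∧
    ¬ FlatIdeals.GlazVasconcelosConjecture :=
  ⟨fun _ _ _ h => h.isHDomain, FlatIdeals.isGeneralizedDedekind_D,
    FlatIdeals.isGeneralizedDedekind_D.isHDomain, FlatIdeals.isLocallyPrincipal_I,
    FlatIdeals.faithfullyFlat_I, FlatIdeals.not_isDivisorial_I, FlatIdeals.not_fg_I,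
    fun h => FlatIdeals.not_fg_I (h FlatIdeals.D FlatIdeals.isGeneralizedDedekind_D.isHDomain
      FlatIdeals.I FlatIdeals.faithfullyFlat_I)⟩
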